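/- Let $d\ge 1$ and $\sigma>0$, and let $y_j=\theta_j+\sigma\xi_j$, $j=1,\dots,d$, where $\theta=(\theta_1,\dots,\theta_d)\in\mathbb R^d$ is unknown and $\xi_1,\dots,\xi_d$ are i.i.d. standard normal random variables; write $\mathbf E_\theta$ for the expectation with respect to the law of $y=(y_1,\dots,y_d)$. Let $Q(\theta)=\sum_{i=1}^d\theta_i^2$ and, for $\Theta\subseteq\mathbb R^d$, let $$R^*_Q(\Theta)=\inf_{\hat T}\,\sup_{\theta\in\Theta}\mathbf E_\theta\big(\hat T-Q(\theta)\big)^2\in[0,\infty],$$ the infimum being over all estimators, i.e. all real-valued measurable functions $\hat T=\hat T(y)$ of the observations. Let $B_2(\kappa)=\{\theta\in\mathbb R^d:\|\theta\|_2\le\kappa\}$ and $B_0(s)=\{\theta\in\mathbb R^d:\theta\text{ has at most } s\text{ non-zero components}\}$. For integers $1\le s\le d$ put $$\bar\psi_\sigma(s,d)=\begin{cases}\sigma^4s^2\log^2(1+d/s^2) & \text{if } s<\sqrt d,\\ \sigma^4 d & \text{if } s\ge\sqrt d.\end{cases}$$ **Theorem.** There exists an absolute constant $c>0$ such that, for any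 integers $s,d$ satisfying $1\le s\le d$ and any $\kappa,\sigma>0$, $$R^*_Q\big(B_2(\kappa)\cap B_0(s)\big)\ \ge\ c\,\min\big\{\kappa^4,\ \max\{\sigma^2\kappa^2,\ \bar\psi_\sigma(s,d)\}\big\}.$$ Moreover, $R^*_Q(B_0(s))=\infty$ for any integers $1\le s\le d$ and any $\sigma>0$. -/

import Mathlib

open MeasureTheory ProbabilityTheory
open scoped ENNReal

namespace SparseSequence

/-- The law `P_θ` of the vector of observations `y_j = θ_j + σ ξ_j`, `j = 1, …, d`, where the
`ξ_j` are i.i.d. standard normal random variables. -/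
noncomputable def obsLaw {d : ℕ} (σ : ℝ) (θ : Fin d → ℝ) : Measure (Fin d → ℝ) :=
  (Measure.pi (fun _ : Fin d => gaussianReal 0 1)).map (fun ξ j => θ j + σ * ξ j)

/-- The maximum squared risk `sup_{θ ∈ Θ} E_θ (T̂ - T(θ))²` (possibly infinite) of an estimator
`T̂`, a function of the observations, of the functional `T` on the class `Θ`. -/
noncomputable def maxRisk {d : ℕ} (σ : ℝ) (T : (Fin d → ℝ) → ℝ) (Θ : Set (Fin d → ℝ))
    (That : (Fin d → ℝ) → ℝ) : ℝ≥0∞ :=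
  ⨆ θ ∈ Θ, ∫⁻ y, ENNReal.ofReal ((That y - T θ) ^ 2) ∂(obsLaw σ θ)

/-- The minimax risk `R*_T(Θ)`: the infimum of the maximum squared risk over all estimators,
that is, over all measurable functions of the observations. -/
noncomputable def minimaxSqRisk {d : ℕ} (σ : ℝ) (T : (Fin d → ℝ) → ℝ)
    (Θ : Set (Fin d → ℝ)) : ℝ≥0∞ :=
  ⨅ (That : (Fin d → ℝ) → ℝ) (_ : Measurable That), maxRisk σ T Θ That

/-- The quadratic functional `Q(θ) = ∑ θ_i²`. -/
def quadFunctional {d : ℕ} (θ : Fin d → ℝ) : ℝ := ∑ i, θ i ^ 2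

/-- The sparsity class `B_0(s)`: vectors with at most `s` non-zero components. -/
def sparseClass (d s : ℕ) : Set (Fin d → ℝ) := {θ | hammingNorm θ ≤ s}

/-- The Euclidean ball `B_2(κ)`: vectors with `‖θ‖₂ = √Q(θ) ≤ κ`. -/
def euclBall (d : ℕ) (κ : ℝ) : Set (Fin d → ℝ) := {θ | Real.sqrt (quadFunctional θ) ≤ κ}

/-- The rate `ψ̄_σ(s,d)`, with its sparse and dense zones. -/
noncomputable def psiBar (σ : ℝ) (s d : ℕ) : ℝ :=
  if (s : ℝ) < Real.sqrt (d : ℝ) then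
    σ ^ 4 * (s : ℝ) ^ 2 * Real.log (1 + (d : ℝ) / (s : ℝ) ^ 2) ^ 2
  else σ ^ 4 * (d : ℝ)

/-- The rate `ψ^Q_σ(s,d,κ) = min {κ⁴, max {σ²κ², ψ̄_σ(s,d)}}`. -/
noncomputable def psiQ (σ : ℝ) (s d : ℕ) (κ : ℝ) : ℝ :=
  min (κ ^ 4) (max (σ ^ 2 * κ ^ 2) (psiBar σ s d))

end SparseSequence

namespace SparseSequence

/-- Tonelli's theorem for a product of nonnegative functions of one coordinate each. -/
lemma lintegral_pi_prod {ι : Type*} [Fintype ι] {X : ι → Type*} [∀ i, MeasurableSpace (X i)]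
    (μ : ∀ i, Measure (X i)) [∀ i, IsProbabilityMeasure (μ i)] {f : ∀ i, X i → ℝ≥0∞}
    (hf : ∀ i, Measurable (f i)) :
    ∫⁻ x, ∏ i, f i (x i) ∂(Measure.pi μ) = ∏ i, ∫⁻ x, f i x ∂(μ i) := by
  have hind : iIndepFun (fun i (x : ∀ i, X i) => f i (x i)) (Measure.pi μ) :=
    iIndepFun_pi (fun i => (hf i).aemeasurable)
  have h := lintegral_prod_eq_prod_lintegral_of_indepFun Finset.univ _ hind
    (fun i => (hf i).comp (measurable_pi_apply i))
  rw [h]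
  refine Finset.prod_congr rfl fun i _ => ?_
  exact (measurePreserving_eval μ i).lintegral_comp (hf i)

/-- The standard Gaussian measure on `ℝ^d`. -/
noncomputable def stdGaussianPi (d : ℕ) : Measure (Fin d → ℝ) :=
  Measure.pi (fun _ : Fin d => gaussianReal 0 1)

instance (d : ℕ) : IsProbabilityMeasure (stdGaussianPi d) := by
  unfold stdGaussianPi; infer_instance

/-- The density of the standard Gaussian measure shifted by `h` with respect to the standard
Gaussian measure. -/
noncomputable def shiftDensity {d : ℕ} (h x : Fin d → ℝ) : ℝ :=
  Real.exp (∑ i, (h i * x i - h i ^ 2 / 2))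

lemma shiftDensity_pos {d : ℕ} (h x : Fin d → ℝ) : 0 < shiftDensity h x := Real.exp_pos _

lemma measurable_shiftDensity {d : ℕ} (h : Fin d → ℝ) : Measurable (shiftDensity h) := by
  unfold shiftDensity; fun_prop

lemma shiftDensity_mul {d : ℕ} (h k x : Fin d → ℝ) :
    shiftDensity h x * shiftDensity k x =
      Real.exp (∑ i, h i * k i) * shiftDensity (h + k) x := by
  simp only [shiftDensity, ← Real.exp_add, ← Finset.sum_add_distrib, Pi.add_apply]
  congr 1
  exact Finset.sum_congr rfl fun i _ => by ring

lemma ofReal_shiftDensity {d : ℕ} (h x : Fin d → ℝ) :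
    ENNReal.ofReal (shiftDensity h x) =
      ∏ i, ENNReal.ofReal (Real.exp (h i * x i - h i ^ 2 / 2)) := by
  rw [shiftDensity, Real.exp_sum, ENNReal.ofReal_prod_of_nonneg fun i _ => (Real.exp_pos _).le]

lemma gaussianReal_one_eq_withDensity (h : ℝ) :
    gaussianReal h 1 =
      (gaussianReal 0 1).withDensity (fun x => ENNReal.ofReal (Real.exp (h * x - h ^ 2 / 2))) := by
  rw [gaussianReal_of_var_ne_zero _ one_ne_zero, gaussianReal_of_var_ne_zero _ one_ne_zero,
    ← withDensity_mul _ (measurable_gaussianPDF _ _) (by fun_prop)]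
  congr 1
  ext x
  simp only [gaussianPDF, Pi.mul_apply, gaussianPDFReal]
  rw [← ENNReal.ofReal_mul (by positivity), mul_assoc _ (Real.exp _), ← Real.exp_add]
  congr 3
  simp only [NNReal.coe_one]
  ring

lemma map_add_stdGaussianPi {d : ℕ} (h : Fin d → ℝ) :
    (stdGaussianPi d).map (fun x => h + x) =
      (stdGaussianPi d).withDensity (fun x => ENNReal.ofReal (shiftDensity h x)) := by
  have h1 : (stdGaussianPi d).map (fun x => h + x) =
      Measure.pi (fun i => gaussianReal (h i) 1) := by
    have := Measure.pi_map_pi (μ := fun _ : Fin d => gaussianReal 0 1)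
      (f := fun i (x : ℝ) => h i + x) (fun i => by fun_prop)
    simp only [gaussianReal_map_const_add, zero_add] at this
    exact this
  rw [h1]
  refine Measure.pi_eq fun s hs => ?_
  rw [withDensity_apply _ (MeasurableSet.univ_pi hs),
    ← lintegral_indicator (MeasurableSet.univ_pi hs)]
  have h2 : ∀ x : Fin d → ℝ,
      (Set.univ.pi s).indicator (fun x => ENNReal.ofReal (shiftDensity h x)) x =
        ∏ i, (s i).indicator (fun t => ENNReal.ofReal (Real.exp (h i * t - h i ^ 2 / 2))) (x i) := by
    intro x
    by_cases hx : x ∈ Set.univ.pi s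
    · rw [Set.indicator_of_mem hx, ofReal_shiftDensity]
      exact Finset.prod_congr rfl fun i _ => by
        rw [Set.indicator_of_mem (hx i (Set.mem_univ i))]
    · rw [Set.indicator_of_notMem hx]
      simp only [Set.mem_univ_pi, not_forall] at hx
      obtain ⟨i, hi⟩ := hx
      exact (Finset.prod_eq_zero (Finset.mem_univ i) (Set.indicator_of_notMem hi _)).symm
  simp_rw [h2]
  rw [stdGaussianPi, lintegral_pi_prod _ fun i => Measurable.indicator (by fun_prop) (hs i)]
  refine Finset.prod_congr rfl fun i _ => ?_
  rw [lintegral_indicator (hs i), gaussianReal_one_eq_withDensity (h i),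
    withDensity_apply _ (hs i)]

lemma lintegral_shiftDensity {d : ℕ} (h : Fin d → ℝ) :
    ∫⁻ x, ENNReal.ofReal (shiftDensity h x) ∂(stdGaussianPi d) = 1 := by
  have h1 := congrArg (fun μ => μ Set.univ) (map_add_stdGaussianPi h)
  simp only [withDensity_apply _ MeasurableSet.univ, Measure.restrict_univ] at h1
  rw [← h1, Measure.map_apply (by fun_prop) MeasurableSet.univ]
  simp

lemma lintegral_shiftDensity_mul {d : ℕ} (h k : Fin d → ℝ) :
    ∫⁻ x, ENNReal.ofReal (shiftDensity h x * shiftDensity k x) ∂(stdGaussianPi d) =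
      ENNReal.ofReal (Real.exp (∑ i, h i * k i)) := by
  simp_rw [shiftDensity_mul, ENNReal.ofReal_mul (Real.exp_pos _).le]
  rw [lintegral_const_mul _ (measurable_shiftDensity _).ennreal_ofReal, lintegral_shiftDensity,
    mul_one]

lemma lintegral_obsLaw {d : ℕ} (σ : ℝ) (θ : Fin d → ℝ) {F : (Fin d → ℝ) → ℝ≥0∞}
    (hF : Measurable F) :
    ∫⁻ y, F y ∂(obsLaw σ θ) = ∫⁻ x, F (θ + σ • x) ∂(stdGaussianPi d) :=
  lintegral_map hF (by fun_prop)

lemma lintegral_obsLaw_add_smul {d : ℕ} (σ : ℝ) (θ h : Fin d → ℝ) {F : (Fin d → ℝ) → ℝ≥0∞}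
    (hF : Measurable F) :
    ∫⁻ y, F y ∂(obsLaw σ (θ + σ • h)) =
      ∫⁻ x, ENNReal.ofReal (shiftDensity h x) * F (θ + σ • x) ∂(stdGaussianPi d) := by
  have hG : Measurable fun x : Fin d → ℝ => F (θ + σ • x) := hF.comp (by fun_prop)
  rw [lintegral_obsLaw _ _ hF]
  have h1 : ∀ x : Fin d → ℝ, F (θ + σ • h + σ • x) = (fun x => F (θ + σ • x)) (h + x) := by
    intro x; simp only [smul_add, add_assoc]
  simp_rw [h1]
  rw [← lintegral_map hG (by fun_prop : Measurable fun x => h + x), map_add_stdGaussianPi,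
    lintegral_withDensity_eq_lintegral_mul _ (measurable_shiftDensity h).ennreal_ofReal hG]
  rfl

lemma lintegral_le_maxRisk {d : ℕ} {σ : ℝ} {T : (Fin d → ℝ) → ℝ} {Θ : Set (Fin d → ℝ)}
    {That : (Fin d → ℝ) → ℝ} {θ : Fin d → ℝ} (hθ : θ ∈ Θ) :
    ∫⁻ y, ENNReal.ofReal ((That y - T θ) ^ 2) ∂(obsLaw σ θ) ≤ maxRisk σ T Θ That :=
  le_iSup₂ (f := fun θ _ => ∫⁻ y, ENNReal.ofReal ((That y - T θ) ^ 2) ∂(obsLaw σ θ)) θ hθ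

lemma minimaxSqRisk_mono {d : ℕ} (σ : ℝ) (T : (Fin d → ℝ) → ℝ) {Θ Θ' : Set (Fin d → ℝ)}
    (h : Θ ⊆ Θ') : minimaxSqRisk σ T Θ ≤ minimaxSqRisk σ T Θ' :=
  iInf₂_mono fun _ _ => biSup_mono fun _ hθ => h hθ

/-- The pointwise inequality behind the comparison of two hypotheses. -/
lemma mul_sq_le_of_le_abs_sub {C δ q₀ q₁ t L : ℝ} (hC : 0 < C) (hδ : 0 ≤ δ)
    (hq : δ ≤ |q₁ - q₀|) (hL : 0 ≤ L) :
    δ ^ 2 * L ≤ 4 * (L * (t - q₁) ^ 2) + 2 * C * (t - q₀) ^ 2 + δ ^ 2 / (2 * C) * L ^ 2 := by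
  have hsq : 0 ≤ 2 * C * (t - q₀) ^ 2 := by positivity
  have hL2 : 0 ≤ δ ^ 2 / (2 * C) * L ^ 2 := by positivity
  rcases le_or_gt (δ / 2) |t - q₁| with h | h
  · have h1 : (δ / 2) ^ 2 ≤ (t - q₁) ^ 2 := by
      rw [← sq_abs (t - q₁)]; gcongr
    nlinarith
  · have h0 : δ / 2 ≤ |t - q₀| := by
      have := abs_sub_le q₁ t q₀
      rw [abs_sub_comm q₁ t] at this
      linarith
    have h1 : (δ / 2) ^ 2 ≤ (t - q₀) ^ 2 := by
      rw [← sq_abs (t - q₀)]; gcongr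
    have h2 : δ ^ 2 * L ≤ δ ^ 2 * (C / 2) + δ ^ 2 / (2 * C) * L ^ 2 := by
      have : δ ^ 2 * (C / 2) + δ ^ 2 / (2 * C) * L ^ 2 - δ ^ 2 * L
          = δ ^ 2 / (2 * C) * (L - C) ^ 2 := by
        field_simp; ring
      have h3 : 0 ≤ δ ^ 2 / (2 * C) * (L - C) ^ 2 := by positivity
      linarith
    have h3 : 0 ≤ L * (t - q₁) ^ 2 := by positivity
    nlinarith

/-- Lower bound on the minimax risk from a simple hypothesis `θ₀` against the uniform mixture of
the hypotheses `θ₀ + σ h_i`, whose `χ²`-divergence is at most `C - 1`. -/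
lemma le_minimaxSqRisk_of_mixture {d : ℕ} {ι : Type*} [Fintype ι] [Nonempty ι] {σ : ℝ}
    {T : (Fin d → ℝ) → ℝ} {Θ : Set (Fin d → ℝ)} {θ₀ : Fin d → ℝ} (hθ₀ : θ₀ ∈ Θ)
    (h : ι → Fin d → ℝ) (hΘ : ∀ i, θ₀ + σ • h i ∈ Θ) {q₁ : ℝ} (hq : ∀ i, T (θ₀ + σ • h i) = q₁)
    {δ C : ℝ} (hδ : 0 ≤ δ) (hsep : δ ≤ |q₁ - T θ₀|) (hC : 0 < C)
    (hχ : ∑ i, ∑ j, Real.exp (∑ l, h i l * h j l) ≤ C * (Fintype.card ι : ℝ) ^ 2) :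
    ENNReal.ofReal (δ ^ 2 / (8 + 4 * C)) ≤ minimaxSqRisk σ T Θ := by
  refine le_iInf₂ fun That hThat => ?_
  set M := maxRisk σ T Θ That
  rcases eq_or_ne M ⊤ with hMtop | hMtop
  · exact hMtop ▸ le_top
  set N : ℝ := (Fintype.card ι : ℝ) with hN
  have hNpos : 0 < N := by rw [hN]; exact_mod_cast Fintype.card_pos
  set L : (Fin d → ℝ) → ℝ := fun x => ∑ i, N⁻¹ * shiftDensity (h i) x with hLdef
  have hLm : Measurable L := by
    refine Finset.measurable_sum _ fun i _ => (measurable_shiftDensity _).const_mul _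
  have hLnn : ∀ x, 0 ≤ L x := fun x =>
    Finset.sum_nonneg fun i _ => mul_nonneg (by positivity) (shiftDensity_pos _ _).le
  have hLofReal : ∀ x, ENNReal.ofReal (L x) =
      ∑ i, ENNReal.ofReal N⁻¹ * ENNReal.ofReal (shiftDensity (h i) x) := by
    intro x
    rw [hLdef, ENNReal.ofReal_sum_of_nonneg fun i _ =>
      mul_nonneg (by positivity) (shiftDensity_pos _ _).le]
    exact Finset.sum_congr rfl fun i _ => ENNReal.ofReal_mul (by positivity)
  have hsumN : ∀ a : ℝ≥0∞, ∑ _i : ι, ENNReal.ofReal N⁻¹ * a = a := by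
    intro a
    rw [Finset.sum_const, nsmul_eq_mul, ← mul_assoc, Finset.card_univ,
      ← ENNReal.ofReal_natCast, ← ENNReal.ofReal_mul (by positivity), mul_inv_cancel₀ hNpos.ne']
    simp
  have hL1 : ∫⁻ x, ENNReal.ofReal (L x) ∂(stdGaussianPi d) = 1 := by
    simp_rw [hLofReal]
    rw [lintegral_finsetSum _ fun i _ =>
      ((measurable_shiftDensity _).ennreal_ofReal.const_mul _)]
    simp_rw [lintegral_const_mul _ (measurable_shiftDensity _).ennreal_ofReal,
      lintegral_shiftDensity]
    exact hsumN 1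
  have hL2 : ∫⁻ x, ENNReal.ofReal (L x ^ 2) ∂(stdGaussianPi d) ≤ ENNReal.ofReal C := by
    have e1 : ∀ x, ENNReal.ofReal (L x ^ 2) = ∑ i, ∑ j, ENNReal.ofReal (N⁻¹ ^ 2) *
        ENNReal.ofReal (shiftDensity (h i) x * shiftDensity (h j) x) := by
      intro x
      rw [hLdef, sq, Finset.sum_mul_sum, ENNReal.ofReal_sum_of_nonneg fun i _ =>
        Finset.sum_nonneg fun j _ => by
          have := shiftDensity_pos (h i) x
          have := shiftDensity_pos (h j) x
          positivity]
      refine Finset.sum_congr rfl fun i _ => ?_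
      rw [ENNReal.ofReal_sum_of_nonneg fun j _ => by
          have := shiftDensity_pos (h i) x
          have := shiftDensity_pos (h j) x
          positivity]
      refine Finset.sum_congr rfl fun j _ => ?_
      rw [← ENNReal.ofReal_mul (by positivity)]
      congr 1; ring
    have hm : ∀ i j, Measurable fun x =>
        ENNReal.ofReal (shiftDensity (h i) x * shiftDensity (h j) x) := fun i j =>
      ((measurable_shiftDensity _).mul (measurable_shiftDensity _)).ennreal_ofReal
    simp_rw [e1]
    rw [lintegral_finsetSum _ fun i _ => Finset.measurable_sum _ fun j _ => (hm i j).const_mul _]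
    simp_rw [lintegral_finsetSum _ fun j _ => (hm _ j).const_mul _,
      lintegral_const_mul _ (hm _ _), lintegral_shiftDensity_mul,
      ← ENNReal.ofReal_mul (show (0:ℝ) ≤ N⁻¹ ^ 2 by positivity)]
    have e2 : ∀ i, ∑ j, ENNReal.ofReal (N⁻¹ ^ 2 * Real.exp (∑ l, h i l * h j l)) =
        ENNReal.ofReal (∑ j, N⁻¹ ^ 2 * Real.exp (∑ l, h i l * h j l)) := fun i =>
      (ENNReal.ofReal_sum_of_nonneg fun j _ => by positivity).symm
    simp_rw [e2]
    rw [← ENNReal.ofReal_sum_of_nonneg fun i _ => Finset.sum_nonneg fun j _ => by positivity]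
    refine ENNReal.ofReal_le_ofReal ?_
    simp_rw [← Finset.mul_sum]
    calc N⁻¹ ^ 2 * ∑ i, ∑ j, Real.exp (∑ l, h i l * h j l) ≤ N⁻¹ ^ 2 * (C * N ^ 2) := by gcongr
      _ = C := by field_simp
  have hR : ∀ q : ℝ, Measurable fun y => ENNReal.ofReal ((That y - q) ^ 2) := fun q =>
    ((hThat.sub_const q).pow_const 2).ennreal_ofReal
  have hR' : ∀ q : ℝ, Measurable fun x : Fin d → ℝ =>
      ENNReal.ofReal ((That (θ₀ + σ • x) - q) ^ 2) := fun q => (hR q).comp (by fun_prop)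
  have hM0 : ∫⁻ x, ENNReal.ofReal ((That (θ₀ + σ • x) - T θ₀) ^ 2) ∂(stdGaussianPi d) ≤ M := by
    rw [← lintegral_obsLaw σ θ₀ (hR _)]
    exact lintegral_le_maxRisk hθ₀
  have hM1 : ∫⁻ x, ENNReal.ofReal (L x * (That (θ₀ + σ • x) - q₁) ^ 2) ∂(stdGaussianPi d) ≤ M := by
    simp_rw [ENNReal.ofReal_mul (hLnn _), hLofReal, Finset.sum_mul]
    rw [lintegral_finsetSum _ fun i _ => by
      exact ((measurable_shiftDensity (h i)).ennreal_ofReal.const_mul _).mul (hR' q₁)]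
    simp_rw [mul_assoc]
    calc _ ≤ ∑ _i : ι, ENNReal.ofReal N⁻¹ * M := by
          refine Finset.sum_le_sum fun i _ => ?_
          rw [lintegral_const_mul _ (by
              exact (measurable_shiftDensity (h i)).ennreal_ofReal.mul (hR' q₁)),
            ← lintegral_obsLaw_add_smul σ θ₀ (h i) (hR q₁)]
          gcongr
          rw [← hq i]
          exact lintegral_le_maxRisk (hΘ i)
      _ = M := hsumN M
  have hmain : ENNReal.ofReal (δ ^ 2) ≤ ENNReal.ofReal 4 * M + ENNReal.ofReal (2 * C) * M +
      ENNReal.ofReal (δ ^ 2 / (2 * C)) * ENNReal.ofReal C := by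
    have hmA : Measurable fun x => ENNReal.ofReal (L x * (That (θ₀ + σ • x) - q₁) ^ 2) := by
      simp_rw [ENNReal.ofReal_mul (hLnn _)]
      exact hLm.ennreal_ofReal.mul (hR' _)
    calc ENNReal.ofReal (δ ^ 2) = ∫⁻ x, ENNReal.ofReal (δ ^ 2) * ENNReal.ofReal (L x) ∂(stdGaussianPi d) := by
          rw [lintegral_const_mul _ hLm.ennreal_ofReal, hL1, mul_one]
      _ ≤ ∫⁻ x, (ENNReal.ofReal 4 * ENNReal.ofReal (L x * (That (θ₀ + σ • x) - q₁) ^ 2) +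
            ENNReal.ofReal (2 * C) * ENNReal.ofReal ((That (θ₀ + σ • x) - T θ₀) ^ 2) +
            ENNReal.ofReal (δ ^ 2 / (2 * C)) * ENNReal.ofReal (L x ^ 2)) ∂(stdGaussianPi d) := by
          refine lintegral_mono fun x => ?_
          have hx := hLnn x
          rw [← ENNReal.ofReal_mul (by positivity), ← ENNReal.ofReal_mul (by positivity),
            ← ENNReal.ofReal_mul (by positivity), ← ENNReal.ofReal_mul (by positivity),
            ← ENNReal.ofReal_add (by positivity) (by positivity),
            ← ENNReal.ofReal_add (by positivity) (by positivity)]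
          exact ENNReal.ofReal_le_ofReal (mul_sq_le_of_le_abs_sub hC hδ hsep hx)
      _ ≤ _ := by
          rw [lintegral_add_right _ ((hLm.pow_const 2).ennreal_ofReal.const_mul _),
            lintegral_add_right _ ((hR' _).const_mul _), lintegral_const_mul _ hmA,
            lintegral_const_mul _ (hR' _),
            lintegral_const_mul _ (hLm.pow_const 2).ennreal_ofReal]
          gcongr
  clear_value M
  lift M to NNReal using hMtop
  rw [← ENNReal.ofReal_coe_nnreal, ← ENNReal.ofReal_mul (by positivity),
    ← ENNReal.ofReal_mul (by positivity), ← ENNReal.ofReal_mul (by positivity),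
    ← ENNReal.ofReal_add (by positivity) (by positivity),
    ← ENNReal.ofReal_add (by positivity) (by positivity),
    ENNReal.ofReal_le_ofReal_iff (by positivity)] at hmain
  rw [← ENNReal.ofReal_coe_nnreal]
  refine ENNReal.ofReal_le_ofReal ?_
  rw [div_le_iff₀ (by positivity)]
  have : δ ^ 2 / (2 * C) * C = δ ^ 2 / 2 := by field_simp
  rw [this] at hmain
  nlinarith

lemma mem_euclBall_of_quadFunctional_le {d : ℕ} {κ : ℝ} (hκ : 0 ≤ κ) {θ : Fin d → ℝ}
    (h : quadFunctional θ ≤ κ ^ 2) : θ ∈ euclBall d κ :=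
  Real.sqrt_le_iff.2 ⟨hκ, h⟩

lemma quadFunctional_single {d : ℕ} (i : Fin d) (a : ℝ) :
    quadFunctional (Pi.single i a) = a ^ 2 := by
  rw [quadFunctional, Finset.sum_eq_single i (fun j _ hj => by simp [hj]) (by simp)]
  simp

lemma single_mem_sparseClass {d s : ℕ} (hs : 1 ≤ s) (i : Fin d) (a : ℝ) :
    Pi.single i a ∈ sparseClass d s := by
  refine le_trans (Finset.card_le_card (t := {i}) fun j hj => ?_) (by simpa using hs)
  by_contra hne
  simp only [Finset.mem_singleton] at hne
  simp [hne] at hj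

/-- The parametric part of the lower bound, from two points on a coordinate axis. -/
lemma parametric_le_minimaxSqRisk {s d : ℕ} (hs : 1 ≤ s) (hsd : s ≤ d) {κ σ : ℝ} (hκ : 0 < κ)
    (hσ : 0 < σ) :
    ENNReal.ofReal (1 / 40 * min (κ ^ 4) (σ ^ 2 * κ ^ 2)) ≤
      minimaxSqRisk σ quadFunctional (euclBall d κ ∩ sparseClass d s) := by
  set t := min κ σ with ht
  have htpos : 0 < t := lt_min hκ hσ
  have htκ : t ≤ κ := min_le_left _ _
  have htσ : t ≤ σ := min_le_right _ _
  let i₀ : Fin d := ⟨0, by omega⟩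
  have hsum : (Pi.single i₀ (κ - t) : Fin d → ℝ) + σ • Pi.single i₀ (t / σ) =
      Pi.single i₀ κ := by
    rw [← Pi.single_smul, ← Pi.single_add]
    congr 1
    simp only [smul_eq_mul]
    field_simp
    ring
  have hκmem : (Pi.single i₀ κ : Fin d → ℝ) ∈ euclBall d κ ∩ sparseClass d s :=
    ⟨mem_euclBall_of_quadFunctional_le hκ.le (quadFunctional_single _ _).le,
      single_mem_sparseClass hs _ _⟩
  have hmem : (Pi.single i₀ (κ - t) : Fin d → ℝ) ∈ euclBall d κ ∩ sparseClass d s := by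
    refine ⟨mem_euclBall_of_quadFunctional_le hκ.le ?_, single_mem_sparseClass hs _ _⟩
    rw [quadFunctional_single]
    nlinarith
  have key := le_minimaxSqRisk_of_mixture (ι := Unit) (σ := σ) (T := quadFunctional)
    hmem (fun _ => Pi.single i₀ (t / σ)) (fun _ => by rw [hsum]; exact hκmem)
    (q₁ := κ ^ 2) (fun _ => by rw [hsum, quadFunctional_single])
    (δ := κ * t) (C := 8) (by positivity)
    (by
      rw [quadFunctional_single]
      refine le_trans ?_ (le_abs_self _)
      nlinarith)
    (by norm_num)
    (by
      have hq : ∑ l, (Pi.single i₀ (t / σ) : Fin d → ℝ) l * (Pi.single i₀ (t / σ) : Fin d → ℝ) l =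
          (t / σ) ^ 2 := by
        rw [← quadFunctional_single i₀ (t / σ)]
        exact Finset.sum_congr rfl fun l _ => (sq _).symm
      simp only [Finset.univ_unique, Finset.sum_singleton, hq, Fintype.card_unit]
      have h1 : (t / σ) ^ 2 ≤ 1 := by
        have : t / σ ≤ 1 := (div_le_one hσ).2 htσ
        have : 0 ≤ t / σ := by positivity
        nlinarith
      have h2 := Real.exp_le_exp.2 h1
      have h3 := Real.exp_one_lt_d9
      norm_num
      linarith)
  refine le_trans (ENNReal.ofReal_le_ofReal ?_) key
  have : min (κ ^ 4) (σ ^ 2 * κ ^ 2) ≤ (κ * t) ^ 2 := by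
    rcases min_choice κ σ with h | h
    · rw [ht, h]; exact (min_le_left _ _).trans (by ring_nf; rfl)
    · rw [ht, h]; exact (min_le_right _ _).trans (by ring_nf; rfl)
  norm_num
  linarith

/-- The sum over all pairs of functions of a weight `a` per coordinate of agreement. -/
lemma sum_sum_prod_ite_eq {m b : ℕ} (a : ℝ) :
    ∑ f : Fin m → Fin b, ∑ g : Fin m → Fin b, ∏ j, (if f j = g j then a else 1) =
      (b : ℝ) ^ m * (b + (a - 1)) ^ m := by
  have h : ∀ f : Fin m → Fin b,
      ∑ g : Fin m → Fin b, ∏ j, (if f j = g j then a else 1) = (b + (a - 1)) ^ m := by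
    intro f
    rw [← Fintype.prod_sum (fun j (y : Fin b) => if f j = y then a else 1)]
    have : ∀ j : Fin m, ∑ y : Fin b, (if f j = y then a else 1) = b + (a - 1) := by
      intro j
      have e : ∀ y : Fin b, (if f j = y then a else 1) = (if f j = y then a - 1 else 0) + 1 := by
        intro y; split_ifs <;> ring
      simp_rw [e, Finset.sum_add_distrib]
      simp [add_comm]
    simp [this]
  simp [h]

/-- The vector with value `a` at one position in each of `m` blocks and `0` elsewhere. -/
noncomputable def blockVec {d m b : ℕ} (e : Fin m × Fin b ↪ Fin d) (a : ℝ) (f : Fin m → Fin b) :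
    Fin d → ℝ :=
  fun i => if ∃ j, e (j, f j) = i then a else 0

lemma blockVec_apply {d m b : ℕ} (e : Fin m × Fin b ↪ Fin d) (a : ℝ) (f : Fin m → Fin b)
    (j : Fin m) (y : Fin b) : blockVec e a f (e (j, y)) = if y = f j then a else 0 := by
  have : (∃ k, e (k, f k) = e (j, y)) ↔ y = f j := by
    constructor
    · rintro ⟨k, hk⟩
      have := e.injective hk
      simp only [Prod.mk.injEq] at this
      rw [← this.2, this.1]
    · rintro rfl; exact ⟨j, rfl⟩
  simp only [blockVec, this]

lemma sum_blockVec_mul {d m b : ℕ} (e : Fin m × Fin b ↪ Fin d) (a : ℝ) (f : Fin m → Fin b)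
    (v : Fin d → ℝ) : ∑ l, blockVec e a f l * v l = ∑ j, a * v (e (j, f j)) := by
  have hinj : Function.Injective fun j => e (j, f j) := fun j k hjk =>
    (Prod.mk.inj (e.injective hjk)).1
  rw [← Finset.sum_subset (Finset.subset_univ (Finset.univ.map ⟨fun j => e (j, f j), hinj⟩)),
    Finset.sum_map]
  · exact Finset.sum_congr rfl fun j _ => by simp [blockVec_apply]
  · intro l _ hl
    have : ¬ ∃ j, e (j, f j) = l := by simpa using hl
    simp [blockVec, this]

lemma hammingNorm_blockVec_le {d m b : ℕ} (e : Fin m × Fin b ↪ Fin d) (a : ℝ)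
    (f : Fin m → Fin b) : hammingNorm (blockVec e a f) ≤ m := by
  calc hammingNorm (blockVec e a f)
      ≤ (Finset.univ.image fun j => e (j, f j)).card := by
        refine Finset.card_le_card fun i hi => ?_
        by_contra hne
        exact (Finset.mem_filter.1 hi).2 (if_neg (by simpa using hne))
    _ ≤ m := Finset.card_image_le.trans (by simp)

lemma exp_sum_blockVec_mul {d m b : ℕ} (e : Fin m × Fin b ↪ Fin d) {a r : ℝ} (ha : a * a = r)
    (f g : Fin m → Fin b) :
    Real.exp (∑ l, blockVec e a f l * blockVec e a g l) =
      ∏ j, (if f j = g j then Real.exp r else 1) := by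
  rw [sum_blockVec_mul, Real.exp_sum]
  refine Finset.prod_congr rfl fun j _ => ?_
  rw [blockVec_apply]
  split_ifs <;> simp [ha]

/-- The sparse part of the lower bound, from the origin and a mixture of `m`-sparse vectors. -/
lemma sparse_le_minimaxSqRisk {m s d : ℕ} (hm : 1 ≤ m) (hms : m ≤ s) (hsd : s ≤ d) {κ σ : ℝ}
    (hκ : 0 < κ) (hσ : 0 < σ) :
    ENNReal.ofReal (1 / 40 * min (κ ^ 4)
        (σ ^ 4 * (m : ℝ) ^ 2 * Real.log (1 + (d : ℝ) / (m : ℝ) ^ 2) ^ 2)) ≤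
      minimaxSqRisk σ quadFunctional (euclBall d κ ∩ sparseClass d s) := by
  have hmR : (0 : ℝ) < m := by exact_mod_cast hm
  have hdR : (0 : ℝ) < d := by exact_mod_cast (by omega : 0 < d)
  set ℓ := Real.log (1 + (d : ℝ) / (m : ℝ) ^ 2) with hℓ
  have hℓpos : 0 < ℓ := Real.log_pos (by have : 0 < (d : ℝ) / (m : ℝ) ^ 2 := by positivity
                                         linarith)
  set r := min (κ ^ 2 / (σ ^ 2 * m)) ℓ with hr
  have hrpos : 0 < r := lt_min (by positivity) hℓpos
  have ha : Real.sqrt r * Real.sqrt r = r := Real.mul_self_sqrt hrpos.le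
  set b := d / m with hb
  have hbpos : 0 < b := Nat.div_pos (by omega) (by omega)
  have hbR : (0 : ℝ) < b := by exact_mod_cast hbpos
  have hd2 : (d : ℝ) ≤ 2 * m * b := by
    have h1 : d < m * b + m := by
      have := Nat.div_add_mod d m
      have := Nat.mod_lt d (show 0 < m by omega)
      rw [hb]; omega
    have h2 : m ≤ m * b := Nat.le_mul_of_pos_right _ hbpos
    have h3 : d ≤ 2 * (m * b) := by omega
    have : (d : ℝ) ≤ 2 * (m * b) := by exact_mod_cast h3
    linarith
  have : Nonempty (Fin b) := ⟨⟨0, hbpos⟩⟩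
  obtain ⟨e⟩ : Nonempty (Fin m × Fin b ↪ Fin d) :=
    Function.Embedding.nonempty_of_card_le (by simpa [hb] using Nat.mul_div_le d m)
  have hQ : ∀ f : Fin m → Fin b,
      quadFunctional ((0 : Fin d → ℝ) + σ • blockVec e (Real.sqrt r) f) = σ ^ 2 * (m * r) := by
    intro f
    have h1 : quadFunctional ((0 : Fin d → ℝ) + σ • blockVec e (Real.sqrt r) f) =
        σ ^ 2 * ∑ l, blockVec e (Real.sqrt r) f l * blockVec e (Real.sqrt r) f l := by
      rw [quadFunctional, Finset.mul_sum]
      refine Finset.sum_congr rfl fun l _ => ?_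
      simp only [Pi.add_apply, Pi.zero_apply, Pi.smul_apply, smul_eq_mul]
      ring
    rw [h1, sum_blockVec_mul]
    simp [blockVec_apply, ha]
  have hQ0 : quadFunctional (0 : Fin d → ℝ) = 0 := by simp [quadFunctional]
  have hΘ : ∀ f : Fin m → Fin b, (0 : Fin d → ℝ) + σ • blockVec e (Real.sqrt r) f ∈
      euclBall d κ ∩ sparseClass d s := by
    intro f
    refine ⟨mem_euclBall_of_quadFunctional_le hκ.le ?_, ?_⟩
    · rw [hQ]
      calc σ ^ 2 * (m * r) ≤ σ ^ 2 * (m * (κ ^ 2 / (σ ^ 2 * m))) := by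
            gcongr; exact min_le_left _ _
        _ = κ ^ 2 := by field_simp
    · rw [zero_add]
      exact (hammingNorm_smul_le_hammingNorm).trans ((hammingNorm_blockVec_le _ _ _).trans hms)
  have hexp : Real.exp r - 1 ≤ d / (m : ℝ) ^ 2 := by
    have h1 : Real.exp r ≤ Real.exp ℓ := Real.exp_le_exp.2 (min_le_right _ _)
    rw [hℓ, Real.exp_log (by positivity)] at h1
    linarith
  have hbase : (b : ℝ) + (Real.exp r - 1) ≤ b * Real.exp (2 / m) := by
    have h1 : (d : ℝ) / (m : ℝ) ^ 2 ≤ b * (2 / m) := by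
      rw [div_le_iff₀ (by positivity)]
      calc (d : ℝ) ≤ 2 * m * b := hd2
        _ = b * (2 / m) * (m : ℝ) ^ 2 := by field_simp
    have h2 := mul_le_mul_of_nonneg_left (Real.add_one_le_exp (2 / (m : ℝ))) hbR.le
    linarith
  have hexp2 : Real.exp 2 ≤ 8 := by
    have h1 : Real.exp 2 = Real.exp 1 * Real.exp 1 := by rw [← Real.exp_add]; norm_num
    have h2 := Real.exp_one_lt_d9
    have h3 := Real.exp_pos 1
    rw [h1]; nlinarith
  have key := le_minimaxSqRisk_of_mixture (σ := σ) (T := quadFunctional)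
    (Θ := euclBall d κ ∩ sparseClass d s) (θ₀ := 0)
    ⟨mem_euclBall_of_quadFunctional_le hκ.le (by rw [hQ0]; positivity), by
      simp [sparseClass]⟩
    (fun f : Fin m → Fin b => blockVec e (Real.sqrt r) f) hΘ hQ
    (δ := σ ^ 2 * (m * r)) (C := 8) (by positivity) (by rw [hQ0, sub_zero]; exact le_abs_self _)
    (by norm_num)
    (by
      simp_rw [exp_sum_blockVec_mul e ha]
      rw [sum_sum_prod_ite_eq]
      have h0 : 0 ≤ (b : ℝ) + (Real.exp r - 1) := by
        have := Real.one_le_exp hrpos.le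
        linarith
      calc (b : ℝ) ^ m * (b + (Real.exp r - 1)) ^ m
          ≤ (b : ℝ) ^ m * (b * Real.exp (2 / m)) ^ m := by gcongr
        _ = Real.exp 2 * ((b : ℝ) ^ m) ^ 2 := by
            rw [mul_pow, ← Real.exp_nat_mul]
            rw [mul_div_cancel₀ _ hmR.ne']
            ring
        _ ≤ 8 * (Fintype.card (Fin m → Fin b) : ℝ) ^ 2 := by
            simp only [Fintype.card_pi, Fintype.card_fin, Finset.prod_const, Finset.card_univ,
              Nat.cast_pow]
            gcongr)
  refine le_trans (ENNReal.ofReal_le_ofReal ?_) key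
  have : min (κ ^ 4) (σ ^ 4 * (m : ℝ) ^ 2 * ℓ ^ 2) ≤ (σ ^ 2 * (m * r)) ^ 2 := by
    rcases min_choice (κ ^ 2 / (σ ^ 2 * m)) ℓ with h | h
    · rw [hr, h]
      refine (min_le_left _ _).trans (le_of_eq ?_)
      field_simp
    · rw [hr, h]
      exact (min_le_right _ _).trans (le_of_eq (by ring))
  norm_num
  linarith

/-- The rate `ψ̄` is attained, up to a constant, by the sparse rate at some sparsity `m ≤ s`. -/
lemma exists_psiBar_le {s d : ℕ} (hs : 1 ≤ s) (hsd : s ≤ d) (σ : ℝ) :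
    ∃ m : ℕ, 1 ≤ m ∧ m ≤ s ∧ psiBar σ s d ≤
      16 * (σ ^ 4 * (m : ℝ) ^ 2 * Real.log (1 + (d : ℝ) / (m : ℝ) ^ 2) ^ 2) := by
  by_cases h : (s : ℝ) < Real.sqrt d
  · refine ⟨s, hs, le_rfl, ?_⟩
    rw [psiBar, if_pos h]
    have : 0 ≤ σ ^ 4 * (s : ℝ) ^ 2 * Real.log (1 + (d : ℝ) / (s : ℝ) ^ 2) ^ 2 := by positivity
    linarith
  · have hm : 1 ≤ Nat.sqrt d := Nat.le_sqrt.2 (by omega)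
    have hmR : (1 : ℝ) ≤ (Nat.sqrt d : ℝ) := by exact_mod_cast hm
    refine ⟨Nat.sqrt d, hm, ?_, ?_⟩
    · have h1 : (Nat.sqrt d : ℝ) ≤ Real.sqrt d := Real.nat_sqrt_le_real_sqrt
      exact_mod_cast h1.trans (not_lt.1 h)
    rw [psiBar, if_neg h]
    set m := Nat.sqrt d
    have h1 : (m : ℝ) ^ 2 ≤ d := by exact_mod_cast Nat.sqrt_le' d
    have h2 : (d : ℝ) ≤ 4 * (m : ℝ) ^ 2 := by
      have h3 : (d : ℝ) < ((m : ℝ) + 1) ^ 2 := by exact_mod_cast Nat.lt_succ_sqrt' d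
      nlinarith
    have h4 : 1 / 2 ≤ Real.log (1 + (d : ℝ) / (m : ℝ) ^ 2) := by
      have h5 : (1 : ℝ) ≤ (d : ℝ) / (m : ℝ) ^ 2 := (one_le_div (by positivity)).2 h1
      have h6 : Real.log 2 ≤ Real.log (1 + (d : ℝ) / (m : ℝ) ^ 2) :=
        Real.log_le_log (by norm_num) (by linarith)
      have := Real.log_two_gt_d9
      linarith
    calc σ ^ 4 * (d : ℝ) ≤ σ ^ 4 * (4 * (m : ℝ) ^ 2) := by gcongr
      _ = 16 * (σ ^ 4 * (m : ℝ) ^ 2 * (1 / 2) ^ 2) := by ring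
      _ ≤ _ := by gcongr

lemma psiQ_le_minimaxSqRisk {s d : ℕ} (hs : 1 ≤ s) (hsd : s ≤ d) {κ σ : ℝ} (hκ : 0 < κ)
    (hσ : 0 < σ) :
    ENNReal.ofReal (1 / 640 * psiQ σ s d κ) ≤
      minimaxSqRisk σ quadFunctional (euclBall d κ ∩ sparseClass d s) := by
  have hκ4 : 0 < κ ^ 4 := by positivity
  rw [psiQ]
  rcases le_total (psiBar σ s d) (σ ^ 2 * κ ^ 2) with h | h
  · rw [max_eq_left h]
    refine le_trans (ENNReal.ofReal_le_ofReal ?_) (parametric_le_minimaxSqRisk hs hsd hκ hσ)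
    have : 0 ≤ min (κ ^ 4) (σ ^ 2 * κ ^ 2) := by positivity
    linarith
  · rw [max_eq_right h]
    obtain ⟨m, hm, hms, hle⟩ := exists_psiBar_le hs hsd σ
    refine le_trans (ENNReal.ofReal_le_ofReal ?_) (sparse_le_minimaxSqRisk hm hms hsd hκ hσ)
    have h1 : min (κ ^ 4) (psiBar σ s d) ≤ 16 * min (κ ^ 4)
        (σ ^ 4 * (m : ℝ) ^ 2 * Real.log (1 + (d : ℝ) / (m : ℝ) ^ 2) ^ 2) := by
      rw [mul_min_of_nonneg _ _ (by norm_num)]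
      exact min_le_min (by linarith) hle
    linarith

lemma minimaxSqRisk_sparseClass_eq_top {s d : ℕ} (hs : 1 ≤ s) (hsd : s ≤ d) {σ : ℝ}
    (hσ : 0 < σ) : minimaxSqRisk σ quadFunctional (sparseClass d s) = ⊤ := by
  refine ENNReal.eq_top_of_forall_nnreal_le fun r => ?_
  set κ := σ + 40 * r / σ ^ 3 + 1 with hκdef
  have hr : (0 : ℝ) ≤ r := r.2
  have h0 : 0 ≤ 40 * (r : ℝ) / σ ^ 3 := by positivity
  have hκ : 0 < κ := by positivity
  have hκσ : σ ≤ κ := by linarith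
  refine le_trans ?_ ((parametric_le_minimaxSqRisk hs hsd hκ hσ).trans
    (minimaxSqRisk_mono σ _ Set.inter_subset_right))
  rw [← ENNReal.ofReal_coe_nnreal]
  refine ENNReal.ofReal_le_ofReal ?_
  have h1 : σ ^ 2 * κ ^ 2 ≤ κ ^ 4 := by
    calc σ ^ 2 * κ ^ 2 ≤ κ ^ 2 * κ ^ 2 := by gcongr
      _ = κ ^ 4 := by ring
  rw [min_eq_right h1]
  have h2 : 40 * (r : ℝ) ≤ σ ^ 2 * κ ^ 2 := by
    calc 40 * (r : ℝ) = σ ^ 2 * (σ * (40 * r / σ ^ 3)) := by field_simp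
      _ ≤ σ ^ 2 * (κ * κ) := by
          gcongr
          linarith
      _ = σ ^ 2 * κ ^ 2 := by ring
  linarith

end SparseSequence

theorem theorem3 :
    (∃ c : ℝ, 0 < c ∧ ∀ s d : ℕ, 1 ≤ s → s ≤ d → ∀ κ σ : ℝ, 0 < κ → 0 < σ →
      ENNReal.ofReal (c * SparseSequence.psiQ σ s d κ) ≤
        SparseSequence.minimaxSqRisk σ SparseSequence.quadFunctional
          (SparseSequence.euclBall d κ ∩ SparseSequence.sparseClass d s)) ∧
    (∀ s d : ℕ, 1 ≤ s → s ≤ d → ∀ σ : ℝ, 0 < σ →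
      SparseSequence.minimaxSqRisk σ SparseSequence.quadFunctional
        (SparseSequence.sparseClass d s) = ⊤) :=
  ⟨⟨1 / 640, by norm_num, fun _ _ hs hsd _ _ hκ hσ =>
    SparseSequence.psiQ_le_minimaxSqRisk hs hsd hκ hσ⟩,
    fun _ _ hs hsd _ hσ => SparseSequence.minimaxSqRisk_sparseClass_eq_top hs hsd hσ⟩
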